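/- Let $k\ge 1$, let $\alpha_0,\dots,\alpha_k\ge 0$ be real numbers, where the case $k=1$, $\alpha_0=\alpha_1=0$ is excluded, and put $$h(\mathbf x)=\prod_{j=0}^k|x_j|^{\alpha_j},\qquad \mu=\alpha_0+\cdots+\alpha_k+\frac{k-1}{2}.$$ For polynomials $u$ in $\mathbf x=(x_0,\dots,x_k)$ with real coefficients, let $$\mathcal D_j u(\mathbf x)=\frac{\partial u}{\partial x_j}(\mathbf x)+\alpha_j\,\frac{u(\mathbf x)-u(\sigma_j\mathbf x)}{x_j}\qquad(j=0,\dots,k)$$ be the (commuting) Dunkl operators, where $\sigma_j$ changes the sign of the $j$-th coordinate, and let $\Delta_h=\mathcal D_0^2+\cdots+\mathcal D_k^2$. A spherical $h$-harmonic of degree $m$ is a homogeneous polynomial $Y$ of degree $m$ with $\Delta_hY=0$; write $Y(\mathcal D)=Y(\mathcal D_0,\dots,\mathcal D_k)$. Let $d\mathbf S$ be the standard surface measure on the unit sphere $\mathbf S^k\subset\mathbb R^{k+1}$. Let $f$ be a homogeneous polynomial of degree $\ell$ and let $Y$ be a spherical $h$-harmonic of degree $m$. If $\ell=m+2r$ with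 $r\in\{0,1,2,\dots\}$, then, for every $\mathbf x\in\mathbb R^{k+1}$ on the right-hand side (where the polynomial $\Delta_h^rY(\mathcal D)f$ is constant), $$\int_{\mathbf S^k}h^2fY\,d\mathbf S=\frac{1}{2^{\ell-1}r!}\,\frac{\prod_{i=0}^k\Gamma(\alpha_i+\frac12)}{\Gamma(m+\mu+r+1)}\,\bigl(\Delta_h^rY(\mathcal D)f\bigr)(\mathbf x).$$ If $\ell<m$ or $\ell-m$ is odd, then $\int_{\mathbf S^k}h^2fY\,d\mathbf S=0$. -/

import Mathlib

open MvPolynomial MeasureTheory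

noncomputable section

namespace DunklSphere

/-- The action `u ↦ u ∘ σ_j` on polynomials of the reflection `σ_j` at the `j`-th coordinate
plane, i.e. the substitution `x_j ↦ -x_j`. -/
def reflect {n : ℕ} (j : Fin n) : MvPolynomial (Fin n) ℝ →ₐ[ℝ] MvPolynomial (Fin n) ℝ :=
  MvPolynomial.aeval fun i => if i = j then -X i else X i

/-- The polynomial `(u(x) - u(σ_j x)) / x_j`. Here `divMonomial` is the quotient of the division
by `x_j`; the division is exact, see `X_mul_diffQuot`. -/
def diffQuot {n : ℕ} (j : Fin n) : MvPolynomial (Fin n) ℝ →ₗ[ℝ] MvPolynomial (Fin n) ℝ where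
  toFun u := (u - reflect j u).divMonomial (Finsupp.single j 1)
  map_add' u v := by
    rw [← add_divMonomial, map_add, add_sub_add_comm]
  map_smul' c u := by
    ext d
    simp [coeff_divMonomial, mul_sub]

/-- The Dunkl operator `𝒟_j u = ∂u/∂x_j + α_j (u - u ∘ σ_j) / x_j` on polynomials. -/
def dunkl {n : ℕ} (α : Fin n → ℝ) (j : Fin n) : Module.End ℝ (MvPolynomial (Fin n) ℝ) :=
  (pderiv j).toLinearMap + α j • diffQuot j

/-- The Dunkl Laplacian `Δ_h = 𝒟_0² + ⋯ + 𝒟_k²`. -/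
def dunklLaplacian {n : ℕ} (α : Fin n → ℝ) : Module.End ℝ (MvPolynomial (Fin n) ℝ) :=
  ∑ j, dunkl α j ^ 2

/-- The operator `Y(𝒟_0, …, 𝒟_k)`: every monomial `c x_0^{q_0} ⋯ x_k^{q_k}` of `Y` is replaced by
`c 𝒟_0^{q_0} ⋯ 𝒟_k^{q_k}`. The order of the factors is immaterial, see `dunkl_commute`. -/
def polyDunkl {n : ℕ} (α : Fin n → ℝ) (Y : MvPolynomial (Fin n) ℝ) :
    Module.End ℝ (MvPolynomial (Fin n) ℝ) :=
  ∑ q ∈ Y.support, Y.coeff q • (List.ofFn fun j => dunkl α j ^ q j).prod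

/-- Spherical `h`-harmonics of degree `m`: the `h`-harmonic homogeneous polynomials of
degree `m`. -/
def IsSphericalHHarmonic {n : ℕ} (α : Fin n → ℝ) (m : ℕ) (Y : MvPolynomial (Fin n) ℝ) : Prop :=
  Y.IsHomogeneous m ∧ dunklLaplacian α Y = 0

/-- The weight function `h(x) = |x_0|^{α_0} ⋯ |x_k|^{α_k}`. -/
def weight {n : ℕ} (α : Fin n → ℝ) (x : EuclideanSpace ℝ (Fin n)) : ℝ :=
  ∏ j, |x j| ^ α j

/-- The constant `μ = α_0 + ⋯ + α_k + (k - 1) / 2`. -/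
def mu {k : ℕ} (α : Fin (k + 1) → ℝ) : ℝ :=
  ∑ j, α j + ((k : ℝ) - 1) / 2

/-- The integral `∫_{S^k} h² f Y dS` over the unit sphere of `ℝ^{k+1}`. Mathlib's
`Measure.toSphere` of Lebesgue measure is the surface measure: the mass of a set `A` is
`k + 1` times the volume of the cone `{t a | 0 < t < 1, a ∈ A}`. -/
def sphereIntegral {k : ℕ} (α : Fin (k + 1) → ℝ) (f Y : MvPolynomial (Fin (k + 1)) ℝ) : ℝ :=
  ∫ x : Metric.sphere (0 : EuclideanSpace ℝ (Fin (k + 1))) 1,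
    weight α x ^ 2 * eval (x : EuclideanSpace ℝ (Fin (k + 1))) f
      * eval (x : EuclideanSpace ℝ (Fin (k + 1))) Y
    ∂(volume : Measure (EuclideanSpace ℝ (Fin (k + 1)))).toSphere

theorem reflect_monomial {n : ℕ} (j : Fin n) (d : Fin n →₀ ℕ) (c : ℝ) :
    reflect j (monomial d c) = monomial d ((-1) ^ d j * c) := by
  rw [reflect, aeval_monomial, Finsupp.prod_fintype _ _ (by simp)]
  rw [monomial_eq, Finsupp.prod_fintype _ _ (by simp)]
  have h : ∀ i, (if i = j then -X i else X i : MvPolynomial (Fin n) ℝ) ^ d i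
      = (if i = j then (-1) ^ d i else 1) * X i ^ d i := by
    intro i
    split_ifs
    · rw [neg_pow]
    · simp
  simp only [h, Finset.prod_mul_distrib, Finset.prod_ite_eq', Finset.mem_univ, if_true]
  simp only [algebraMap_eq, map_mul, map_pow, map_neg, map_one]
  ring

theorem coeff_reflect {n : ℕ} (j : Fin n) (u : MvPolynomial (Fin n) ℝ) (d : Fin n →₀ ℕ) :
    coeff d (reflect j u) = (-1) ^ d j * coeff d u := by
  induction u using MvPolynomial.induction_on' with
  | monomial e c =>
    rw [reflect_monomial, coeff_monomial, coeff_monomial]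
    split_ifs with h
    · rw [h]
    · simp
  | add p q hp hq => simp [hp, hq, mul_add]

/-- The division by `x_j` in `diffQuot` is exact. -/
theorem X_mul_diffQuot {n : ℕ} (j : Fin n) (u : MvPolynomial (Fin n) ℝ) :
    X j * diffQuot j u = u - reflect j u := by
  ext d
  by_cases h : d j = 0
  · rw [coeff_X_mul', if_neg (by simpa using h)]
    simp [coeff_reflect, h]
  · rw [coeff_X_mul', if_pos (by simpa using h)]
    have : Finsupp.single j 1 + (d - Finsupp.single j 1) = d :=
      add_tsub_cancel_of_le (by simpa [Nat.one_le_iff_ne_zero] using h)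
    simp only [diffQuot, LinearMap.coe_mk, AddHom.coe_mk, coeff_divMonomial, this]

/-- The Dunkl operator is given by its usual formula at every point with `x_j ≠ 0`. -/
theorem eval_dunkl {n : ℕ} (α : Fin n → ℝ) (j : Fin n) (u : MvPolynomial (Fin n) ℝ)
    (x : Fin n → ℝ) (hx : x j ≠ 0) :
    eval x (dunkl α j u) = eval x (pderiv j u)
      + α j * ((eval x u - eval (Function.update x j (-x j)) u) / x j) := by
  have h := congrArg (eval x) (X_mul_diffQuot j u)
  have h2 : eval x (reflect j u) = eval (Function.update x j (-x j)) u := by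
    induction u using MvPolynomial.induction_on with
    | C a => simp [reflect]
    | add p q hp hq =>
      simp [hp (congrArg (eval x) (X_mul_diffQuot j p)),
        hq (congrArg (eval x) (X_mul_diffQuot j q))]
    | mul_X p i hp =>
      rw [map_mul, map_mul, map_mul, hp (congrArg (eval x) (X_mul_diffQuot j p))]
      by_cases hij : i = j
      · subst hij; simp [reflect]
      · simp [reflect, hij]
  rw [map_mul, map_sub, eval_X, h2] at h
  rw [← h, mul_div_cancel_left₀ _ hx]
  simp [dunkl]

theorem coeff_dunkl {n : ℕ} (α : Fin n → ℝ) (j : Fin n) (u : MvPolynomial (Fin n) ℝ)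
    (d : Fin n →₀ ℕ) :
    coeff d (dunkl α j u)
      = ((d j + 1 : ℝ) + α j * (1 - (-1) ^ (d j + 1))) * coeff (d + Finsupp.single j 1) u := by
  have h1 : coeff d (pderiv j u) = (d j + 1 : ℝ) * coeff (d + Finsupp.single j 1) u := by
    rw [coeff_pderiv]
    ring
  have h2 : coeff d (diffQuot j u)
      = (1 - (-1) ^ (d j + 1)) * coeff (d + Finsupp.single j 1) u := by
    simp only [diffQuot, LinearMap.coe_mk, AddHom.coe_mk, coeff_divMonomial, coeff_sub,
      coeff_reflect, add_comm (Finsupp.single j 1) d]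
    simp [pow_succ]
    ring
  simp [dunkl, h1, h2]
  ring

/-- The Dunkl operators commute. -/
theorem dunkl_commute {n : ℕ} (α : Fin n → ℝ) (i j : Fin n) :
    Commute (dunkl α i) (dunkl α j) := by
  refine LinearMap.ext fun u => MvPolynomial.ext _ _ fun d => ?_
  by_cases hij : i = j
  · rw [hij]
  · simp only [Module.End.mul_apply, coeff_dunkl, Finsupp.add_apply,
      Finsupp.single_apply, if_neg hij, if_neg (Ne.symm hij),
      add_right_comm d (Finsupp.single j 1) (Finsupp.single i 1)]
    simp only [add_zero]
    ring

end DunklSphere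

end

/-!
Write `G(u) = ∫ h² u e^{-|x|²} dx` over `ℝ^{k+1}`. In polar coordinates, the radial factor of a
homogeneous polynomial of degree `N` is `Γ(μ + 1 + N / 2) / 2`, so the spherical integral is
`2 G(f Y) / Γ(μ + 1 + (l + m) / 2)` (`sphereIntegral_mul_Gamma`), and it suffices to compute
`G(f Y)`. The Gaussian integral splits into one-dimensional moments, so that `G` is given by an
explicit formula on monomials (`gaussFunctional`), and what remains is algebra.

Integration by parts (`gaussFunctional_by_parts`) says that the adjoint of `𝒟_j` with respect to
`G(u v)` is `2 x_j - 𝒟_j`, which has two consequences.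

* Since `[Δ_h, x_j] = 2 𝒟_j`, the operator `x_j - 𝒟_j / 2` is the conjugate of multiplication by
  `x_j` with `e^{-Δ_h / 4}`. Hence `G(P(𝒟) u) = 2^m G(u e^{-Δ_h / 4} P)` for `P` homogeneous of
  degree `m` (`gaussFunctional_polyDunkl`), and `e^{-Δ_h / 4} Y = Y` if `Y` is `h`-harmonic. So
  `G(f Y) = 2^{-m} G(Y(𝒟) f)`.
* Euler's identity gives `G(Δ_h u) = 2 d G(u)` for `u` homogeneous of degree `d`
  (`gaussFunctional_dunklLaplacian`), so for `d = 2 r` the value `G(u)` is the constant `Δ_h^r u`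
  times `G(1) / (4^r r!)`, with `G(1) = ∏ Γ(α_j + 1 / 2)` (`eval_dunklLaplacian_pow`).

With `u = Y(𝒟) f` this is the formula. If `l < m` then `Y(𝒟) f = 0`, and if `l - m` is odd then
`f Y` has odd degree, where `G` vanishes.
-/

namespace DunklSphere

/-! ### Dunkl operators and multiplication by coordinates -/

theorem dunkl_monomial {n : ℕ} (α : Fin n → ℝ) (j : Fin n) (d : Fin n →₀ ℕ) (c : ℝ) :
    dunkl α j (monomial d c)
      = monomial (d - Finsupp.single j 1) ((d j + α j * (1 - (-1) ^ d j)) * c) := by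
  ext e
  rw [coeff_dunkl, coeff_monomial, coeff_monomial]
  by_cases hd : d j = 0
  · have h : d ≠ e + Finsupp.single j 1 := by
      intro h
      have := DFunLike.congr_fun h j
      simp [hd] at this
    simp [h, hd]
  · have hle : Finsupp.single j 1 ≤ d := by simpa [Nat.one_le_iff_ne_zero] using hd
    have h : d = e + Finsupp.single j 1 ↔ d - Finsupp.single j 1 = e :=
      ⟨fun h => by rw [h, add_tsub_cancel_right], fun h => by rw [← h, tsub_add_cancel_of_le hle]⟩
    simp only [h]
    split_ifs with h'
    · have : d j = e j + 1 := by rw [h.2 h']; simp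
      rw [this]
      push_cast
      ring
    · simp

theorem dunkl_C {n : ℕ} (α : Fin n → ℝ) (j : Fin n) (a : ℝ) : dunkl α j (C a) = 0 := by
  rw [C_apply, dunkl_monomial]
  simp

theorem dunkl_X_mul_of_ne {n : ℕ} (α : Fin n → ℝ) {i j : Fin n} (hij : i ≠ j)
    (u : MvPolynomial (Fin n) ℝ) : dunkl α i (X j * u) = X j * dunkl α i u := by
  ext d
  rw [coeff_dunkl, coeff_X_mul', coeff_X_mul']
  simp only [Finsupp.mem_support_iff, Finsupp.add_apply, Finsupp.single_apply, if_neg hij, add_zero,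
    coeff_dunkl]
  split_ifs with h
  · have : d + Finsupp.single i 1 - Finsupp.single j 1
        = d - Finsupp.single j 1 + Finsupp.single i 1 := by
      ext t
      by_cases h1 : i = t <;> by_cases h2 : j = t
      · exact absurd (h1.trans h2.symm) hij
      all_goals simp [h1, h2]
    rw [this]
    simp [Ne.symm hij]
  · simp

theorem dunkl_sq_X_mul_self {n : ℕ} (α : Fin n → ℝ) (j : Fin n) (u : MvPolynomial (Fin n) ℝ) :
    (dunkl α j ^ 2) (X j * u) = X j * (dunkl α j ^ 2) u + 2 * dunkl α j u := by
  ext d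
  rw [two_mul, coeff_add, coeff_add, coeff_X_mul', sq]
  simp only [Module.End.mul_apply, coeff_dunkl]
  have h1 : coeff (d + Finsupp.single j 1 + Finsupp.single j 1) (X j * u)
      = coeff (d + Finsupp.single j 1) u := by
    rw [add_comm _ (Finsupp.single j 1), coeff_X_mul]
  rw [h1]
  by_cases h : d j = 0
  · simp [h]
    ring
  · obtain ⟨t, ht⟩ := Nat.exists_eq_succ_of_ne_zero h
    have h2 : d - Finsupp.single j 1 + Finsupp.single j 1 = d :=
      tsub_add_cancel_of_le (by simpa [Nat.one_le_iff_ne_zero] using h)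
    rw [if_pos (by simpa using h), h2]
    simp [ht, pow_succ]
    ring

/-- The commutator of the Dunkl Laplacian with multiplication by a coordinate is `2 𝒟_j`. -/
theorem dunklLaplacian_X_mul {n : ℕ} (α : Fin n → ℝ) (j : Fin n) (u : MvPolynomial (Fin n) ℝ) :
    dunklLaplacian α (X j * u) = X j * dunklLaplacian α u + 2 * dunkl α j u := by
  have h : ∀ i, (dunkl α i ^ 2) (X j * u)
      = X j * (dunkl α i ^ 2) u + if i = j then 2 * dunkl α j u else 0 := by
    intro i
    split_ifs with hij
    · rw [hij, dunkl_sq_X_mul_self]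
    · simp [sq, dunkl_X_mul_of_ne α hij]
  simp only [dunklLaplacian, LinearMap.sum_apply, h, Finset.sum_add_distrib, Finset.mul_sum]
  simp

theorem dunklLaplacian_commute_dunkl {n : ℕ} (α : Fin n → ℝ) (j : Fin n) :
    Commute (dunklLaplacian α) (dunkl α j) :=
  Commute.sum_left _ _ _ fun i _ => (dunkl_commute α i j).pow_left 2

theorem dunklLaplacian_pow_X_mul {n : ℕ} (α : Fin n → ℝ) (j : Fin n) (s : ℕ)
    (u : MvPolynomial (Fin n) ℝ) :
    (dunklLaplacian α ^ (s + 1)) (X j * u)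
      = X j * (dunklLaplacian α ^ (s + 1)) u
        + (2 * (s + 1 : ℝ)) • dunkl α j ((dunklLaplacian α ^ s) u) := by
  induction s with
  | zero =>
    simp [dunklLaplacian_X_mul, smul_eq_C_mul,
      show (C 2 : MvPolynomial (Fin n) ℝ) = 2 from map_ofNat C 2]
  | succ s ih =>
    have hc : ∀ v, dunklLaplacian α (dunkl α j v) = dunkl α j (dunklLaplacian α v) := fun v =>
      LinearMap.congr_fun (dunklLaplacian_commute_dunkl α j).eq v
    rw [pow_succ', Module.End.mul_apply, ih, map_add, dunklLaplacian_X_mul, map_smul, hc]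
    simp only [← Module.End.mul_apply (dunklLaplacian α), ← pow_succ']
    simp only [smul_eq_C_mul]
    push_cast
    simp only [map_add, map_mul, map_natCast, map_ofNat, map_one]
    ring

/-! ### The calculus of Dunkl operators -/

open scoped IsMulCommutative in
/-- The map `P ↦ P(𝒟_0, …, 𝒟_k)` is an algebra homomorphism, because the `𝒟_j` generate a
commutative subalgebra. -/
theorem exists_algHom_eq_polyDunkl {n : ℕ} (α : Fin n → ℝ) :
    ∃ Φ : MvPolynomial (Fin n) ℝ →ₐ[ℝ] Module.End ℝ (MvPolynomial (Fin n) ℝ),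
      (∀ j, Φ (X j) = dunkl α j) ∧ ∀ P, Φ P = polyDunkl α P := by
  have := Algebra.isMulCommutative_adjoin ℝ (s := Set.range (dunkl α)) (by
    rintro _ ⟨i, rfl⟩ _ ⟨j, rfl⟩
    exact dunkl_commute α i j)
  let D : Fin n → Algebra.adjoin ℝ (Set.range (dunkl α)) := fun j => ⟨dunkl α j, Algebra.subset_adjoin ⟨j, rfl⟩⟩
  refine ⟨(Algebra.adjoin ℝ (Set.range (dunkl α))).val.comp (aeval D), fun j => by simp [D], fun P => ?_⟩
  rw [polyDunkl, AlgHom.comp_apply, aeval_def, eval₂_eq', map_sum]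
  refine Finset.sum_congr rfl fun q _ => ?_
  rw [← Algebra.smul_def, map_smul, ← List.prod_ofFn, map_list_prod, List.map_ofFn]
  rfl

theorem polyDunkl_X_mul {n : ℕ} (α : Fin n → ℝ) (j : Fin n) (P u : MvPolynomial (Fin n) ℝ) :
    polyDunkl α (X j * P) u = polyDunkl α P (dunkl α j u) := by
  obtain ⟨Φ, hX, hΦ⟩ := exists_algHom_eq_polyDunkl α
  rw [← hΦ, ← hΦ, mul_comm, map_mul, hX, Module.End.mul_apply]

theorem polyDunkl_add {n : ℕ} (α : Fin n → ℝ) (P Q : MvPolynomial (Fin n) ℝ) :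
    polyDunkl α (P + Q) = polyDunkl α P + polyDunkl α Q := by
  obtain ⟨Φ, -, hΦ⟩ := exists_algHom_eq_polyDunkl α
  rw [← hΦ, ← hΦ, ← hΦ, map_add]

theorem polyDunkl_C {n : ℕ} (α : Fin n → ℝ) (a : ℝ) (u : MvPolynomial (Fin n) ℝ) :
    polyDunkl α (C a) u = a • u := by
  obtain ⟨Φ, -, hΦ⟩ := exists_algHom_eq_polyDunkl α
  rw [← hΦ, ← algebraMap_eq, AlgHom.commutes]
  rfl

theorem dunklLaplacian_pow_mul_polyDunkl {n : ℕ} (α : Fin n → ℝ) (r : ℕ)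
    (P : MvPolynomial (Fin n) ℝ) :
    dunklLaplacian α ^ r * polyDunkl α P = polyDunkl α ((∑ j, X j ^ 2) ^ r * P) := by
  obtain ⟨Φ, hX, hΦ⟩ := exists_algHom_eq_polyDunkl α
  rw [← hΦ, ← hΦ, map_mul, map_pow, map_sum]
  simp only [map_pow, hX, dunklLaplacian]

theorem degree_eq_of_coeff_ne_zero {n m : ℕ} {p : MvPolynomial (Fin n) ℝ}
    (hp : p.IsHomogeneous m) {d : Fin n →₀ ℕ} (hd : coeff d p ≠ 0) : d.degree = m := by
  rw [Finsupp.degree_eq_weight_one]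
  exact hp hd

theorem isHomogeneous_of_degree_eq {n m : ℕ} {p : MvPolynomial (Fin n) ℝ}
    (h : ∀ d, coeff d p ≠ 0 → d.degree = m) : p.IsHomogeneous m := by
  intro d hd
  have := h d hd
  rwa [Finsupp.degree_eq_weight_one] at this

/-- Induction on homogeneous polynomials, multiplying by one coordinate at a time. -/
theorem homogeneous_induction {n : ℕ} {M : ℕ → MvPolynomial (Fin n) ℝ → Prop}
    (zero : ∀ m, M m 0) (const : ∀ a, M 0 (C a))
    (add : ∀ m p q, M m p → M m q → M m (p + q))
    (X_mul : ∀ m p j, M m p → M (m + 1) (X j * p))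
    {m : ℕ} {p : MvPolynomial (Fin n) ℝ} (hp : p.IsHomogeneous m) : M m p := by
  have key : ∀ (d : Fin n →₀ ℕ) (a : ℝ), M d.degree (monomial d a) := by
    intro d a
    have : ∃ t, (monomial d a).IsHomogeneous t ∧ M t (monomial d a) := by
      refine induction_on_monomial (motive := fun p => ∃ t, p.IsHomogeneous t ∧ M t p)
        (fun a => ⟨0, isHomogeneous_C _ a, const a⟩) ?_ d a
      rintro p j ⟨t, ht, hM⟩
      exact ⟨t + 1, ht.mul (isHomogeneous_X _ j), mul_comm p (X j) ▸ X_mul t p j hM⟩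
    obtain ⟨t, ht, hM⟩ := this
    by_cases ha : a = 0
    · rw [ha, map_zero]
      exact zero _
    · rwa [(isHomogeneous_monomial a rfl).inj_right ht (by simpa using ha)]
  rw [p.as_sum]
  refine Finset.sum_induction _ (M m) (add m) (zero m) fun d hd => ?_
  rw [← degree_eq_of_coeff_ne_zero hp (mem_support_iff.1 hd)]
  exact key _ _

/-- `P(𝒟)` lowers degrees by `m` when `P` is homogeneous of degree `m`. -/
theorem degree_of_coeff_polyDunkl_ne_zero {n : ℕ} (α : Fin n → ℝ) {m l : ℕ}
    {P u : MvPolynomial (Fin n) ℝ} (hP : P.IsHomogeneous m) (hu : u.IsHomogeneous l)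
    {d : Fin n →₀ ℕ} (hd : coeff d (polyDunkl α P u) ≠ 0) : d.degree + m = l := by
  revert u l d
  refine homogeneous_induction (M := fun m P => ∀ {l : ℕ} {u : MvPolynomial (Fin n) ℝ},
    u.IsHomogeneous l → ∀ {d : Fin n →₀ ℕ}, coeff d (polyDunkl α P u) ≠ 0 → d.degree + m = l)
    ?_ ?_ ?_ ?_ hP
  · intro m l u _ d hd
    rw [← C_0, polyDunkl_C] at hd
    simp at hd
  · intro a l u hu d hd
    rw [polyDunkl_C, coeff_smul] at hd
    exact degree_eq_of_coeff_ne_zero hu (right_ne_zero_of_mul hd)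
  · intro m p q hp hq l u hu d hd
    rw [polyDunkl_add, LinearMap.add_apply, coeff_add] at hd
    by_cases h : coeff d (polyDunkl α p u) = 0
    · exact hq hu (by simpa [h] using hd)
    · exact hp hu h
  · intro m p j hp l u hu d hd
    rw [polyDunkl_X_mul] at hd
    have hD : ∀ e, coeff e (dunkl α j u) ≠ 0 → e.degree + 1 = l := by
      intro e he
      rw [coeff_dunkl] at he
      simpa using degree_eq_of_coeff_ne_zero hu (right_ne_zero_of_mul he)
    cases l with
    | zero =>
      have h0 : dunkl α j u = 0 := by
        ext e
        by_contra he
        exact absurd (hD e he) (by simp)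
      simp [h0] at hd
    | succ l =>
      have hDu : (dunkl α j u).IsHomogeneous l := by
        refine isHomogeneous_of_degree_eq fun e he => ?_
        simpa using hD e he
      have := hp hDu hd
      omega

/-! ### The Gaussian functional -/

noncomputable section

/-- The moment `∫ |x|^{2a} x^d e^{-x²} dx` in closed form. -/
def gaussMoment (a : ℝ) (d : ℕ) : ℝ :=
  if Even d then Real.Gamma (a + (d + 1) / 2) else 0

/-- The linear functional `u ↦ ∫ h² u e^{-|x|²} dx` on polynomials, given by its values on
monomials. -/
def gaussFunctional {n : ℕ} (α : Fin n → ℝ) : MvPolynomial (Fin n) ℝ →ₗ[ℝ] ℝ :=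
  (basisMonomials (Fin n) ℝ).constr ℝ fun d => ∏ j, gaussMoment (α j) (d j)

end

theorem gaussFunctional_monomial {n : ℕ} (α : Fin n → ℝ) (d : Fin n →₀ ℕ) (c : ℝ) :
    gaussFunctional α (monomial d c) = c * ∏ j, gaussMoment (α j) (d j) := by
  have h : monomial d c = c • basisMonomials (Fin n) ℝ d := by simp [smul_monomial]
  rw [h, map_smul, gaussFunctional, Module.Basis.constr_basis, smul_eq_mul]

theorem gaussMoment_add_two {a : ℝ} (ha : 0 ≤ a) (d : ℕ) :
    2 * gaussMoment a (d + 2) = (d + 1 + 2 * a) * gaussMoment a d := by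
  have hd : Even (d + 2) ↔ Even d := by simp [Nat.even_add]
  simp only [gaussMoment, hd]
  split_ifs
  · have h : a + (((d + 2 : ℕ) : ℝ) + 1) / 2 = a + ((d : ℝ) + 1) / 2 + 1 := by push_cast; ring
    rw [h, Real.Gamma_add_one (by positivity)]
    ring
  · simp

/-- The recursion for the moments, in the form of integration by parts: `c` and `d` are the
exponents of two polynomials that are multiplied. -/
theorem gaussMoment_by_parts {a : ℝ} (ha : 0 ≤ a) (c d : ℕ) :
    (c + a * (1 - (-1) ^ c)) * gaussMoment a (c - 1 + d)
      + (d + a * (1 - (-1) ^ d)) * gaussMoment a (c + (d - 1))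
      = 2 * gaussMoment a (1 + c + d) := by
  -- If `c` and `d` have the same parity, all three exponents are odd and all moments vanish, except
  -- where `c - 1` or `d - 1` is truncated, and there the coefficient vanishes.
  have key : ∀ c d : ℕ, Even c → Odd d →
      (c + a * (1 - (-1) ^ c)) * gaussMoment a (c - 1 + d)
        + (d + a * (1 - (-1) ^ d)) * gaussMoment a (c + (d - 1))
        = 2 * gaussMoment a (1 + c + d) := by
    intro c d hc hd
    obtain ⟨t, rfl⟩ : ∃ t, d = t + 1 := ⟨d - 1, (Nat.sub_add_cancel hd.pos).symm⟩
    rw [hc.neg_one_pow, hd.neg_one_pow, show 1 + c + (t + 1) = c + t + 2 by ring,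
      gaussMoment_add_two ha]
    rcases Nat.eq_zero_or_pos c with rfl | hc0
    · simp only [Nat.cast_zero, zero_add, sub_self, mul_zero, zero_mul, Nat.add_sub_cancel]
      push_cast
      ring
    · rw [show c - 1 + (t + 1) = c + t by omega, Nat.add_sub_cancel]
      push_cast
      ring
  have odd_moment : ∀ t, ¬ Even t → gaussMoment a t = 0 := fun t ht => by simp [gaussMoment, ht]
  rcases Nat.even_or_odd c with hc | hc <;> rcases Nat.even_or_odd d with hd | hd
  · have h1 : (c : ℝ) * gaussMoment a (c - 1 + d) = 0 := by
      rcases Nat.eq_zero_or_pos c with rfl | h0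
      · simp
      · rw [odd_moment _ (by grind), mul_zero]
    have h2 : (d : ℝ) * gaussMoment a (c + (d - 1)) = 0 := by
      rcases Nat.eq_zero_or_pos d with rfl | h0
      · simp
      · rw [odd_moment _ (by grind), mul_zero]
    rw [odd_moment (1 + c + d) (by grind), hc.neg_one_pow, hd.neg_one_pow]
    linear_combination h1 + h2
  · exact key c d hc hd
  · have := key d c hd hc
    rw [show d - 1 + c = c + (d - 1) by ring, show d + (c - 1) = c - 1 + d by ring,
      show 1 + d + c = 1 + c + d by ring] at this
    linear_combination this
  · rw [odd_moment (c - 1 + d) (by grind), odd_moment (c + (d - 1)) (by grind),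
      odd_moment (1 + c + d) (by grind)]
    simp

/-- The adjoint of `𝒟_j` for the pairing `(u, v) ↦ ∫ h² u v e^{-|x|²} dx` is `2 x_j - 𝒟_j`. -/
theorem gaussFunctional_by_parts {n : ℕ} (α : Fin n → ℝ) (hα : ∀ j, 0 ≤ α j) (j : Fin n)
    (u v : MvPolynomial (Fin n) ℝ) :
    gaussFunctional α (dunkl α j u * v) + gaussFunctional α (u * dunkl α j v)
      = 2 * gaussFunctional α (X j * u * v) := by
  induction u using MvPolynomial.induction_on' with
  | add p q hp hq =>
    simp only [map_add, add_mul, mul_add] at hp hq ⊢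
    linear_combination hp + hq
  | monomial c a =>
    induction v using MvPolynomial.induction_on' with
    | add p q hp hq =>
      simp only [map_add, mul_add] at hp hq ⊢
      linear_combination hp + hq
    | monomial d b =>
      rw [X, dunkl_monomial, dunkl_monomial, monomial_mul, monomial_mul, monomial_mul, monomial_mul,
        gaussFunctional_monomial, gaussFunctional_monomial, gaussFunctional_monomial]
      have h := gaussMoment_by_parts (hα j) (c j) (d j)
      simp only [Fintype.prod_eq_mul_prod_compl j]
      have h1 : ∀ e : Fin n →₀ ℕ, (∀ i, i ≠ j → e i = c i + d i) →
          ∏ i ∈ {j}ᶜ, gaussMoment (α i) (e i) = ∏ i ∈ {j}ᶜ, gaussMoment (α i) (c i + d i) :=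
        fun e he => Finset.prod_congr rfl fun i hi => by rw [he i (by simpa using hi)]
      rw [h1 (c - Finsupp.single j 1 + d) (fun i hi => by simp [Ne.symm hi]),
        h1 (c + (d - Finsupp.single j 1)) (fun i hi => by simp [Ne.symm hi]),
        h1 (Finsupp.single j 1 + c + d) (fun i hi => by simp [Ne.symm hi])]
      simp only [Finsupp.add_apply, Finsupp.tsub_apply, Finsupp.single_eq_same]
      linear_combination
        (a * b * ∏ i ∈ {j}ᶜ, gaussMoment (α i) (c i + d i)) * h

/-- The functional is determined on homogeneous polynomials by Euler's identity
`∑ x_j ∂_j u = d u`. -/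
theorem gaussFunctional_dunklLaplacian {n : ℕ} (α : Fin n → ℝ) (hα : ∀ j, 0 ≤ α j) {d : ℕ}
    {u : MvPolynomial (Fin n) ℝ} (hu : u.IsHomogeneous d) :
    gaussFunctional α (dunklLaplacian α u) = 2 * d * gaussFunctional α u := by
  have hL : gaussFunctional α (dunklLaplacian α u)
      = 2 * ∑ j, gaussFunctional α (X j * dunkl α j u) := by
    rw [dunklLaplacian, LinearMap.sum_apply, map_sum, Finset.mul_sum]
    refine Finset.sum_congr rfl fun j _ => ?_
    have h := gaussFunctional_by_parts α hα j (dunkl α j u) 1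
    rw [← C_1, dunkl_C, mul_zero, map_zero, add_zero, C_1, mul_one, mul_one] at h
    rw [sq, Module.End.mul_apply, h]
  have hE : ∀ (e : Fin n →₀ ℕ) (a : ℝ) (j : Fin n),
      gaussFunctional α (X j * dunkl α j (monomial e a))
        = e j * gaussFunctional α (monomial e a) := by
    intro e a j
    rw [dunkl_monomial, X, monomial_mul, gaussFunctional_monomial, gaussFunctional_monomial]
    by_cases h0 : e j = 0
    · simp [h0]
    have he : Finsupp.single j 1 + (e - Finsupp.single j 1) = e :=
      add_tsub_cancel_of_le (by simpa [Nat.one_le_iff_ne_zero] using h0)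
    rw [he]
    -- The reflection term contributes only for odd `e j`, where the moment vanishes.
    rcases Nat.even_or_odd (e j) with h | h
    · rw [h.neg_one_pow]
      ring
    · have : ∏ i, gaussMoment (α i) (e i) = 0 :=
        Finset.prod_eq_zero (Finset.mem_univ j) (by simp [gaussMoment, h])
      simp [this]
  rw [hL, mul_assoc]
  congr 1
  rw [u.as_sum]
  simp only [map_sum, Finset.mul_sum]
  rw [Finset.sum_comm]
  refine Finset.sum_congr rfl fun e he => ?_
  simp only [hE]
  rw [← Finset.sum_mul, ← Nat.cast_sum, ← Finsupp.degree_eq_sum,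
    degree_eq_of_coeff_ne_zero hu (mem_support_iff.1 he)]

theorem gaussFunctional_of_odd {n : ℕ} (α : Fin n → ℝ) {d : ℕ} (hd : Odd d)
    {u : MvPolynomial (Fin n) ℝ} (hu : u.IsHomogeneous d) : gaussFunctional α u = 0 := by
  rw [u.as_sum, map_sum]
  refine Finset.sum_eq_zero fun e he => ?_
  rw [gaussFunctional_monomial]
  have : ∃ j, ¬ Even (e j) := by
    by_contra! h
    have := degree_eq_of_coeff_ne_zero hu (mem_support_iff.1 he)
    rw [Finsupp.degree_eq_sum] at this
    exact (Nat.not_even_iff_odd.2 hd) (this ▸ Finset.even_sum _ fun j _ => h j)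
  obtain ⟨j, hj⟩ := this
  rw [Finset.prod_eq_zero (Finset.mem_univ j) (by simp [gaussMoment, hj]), mul_zero]

theorem dunklLaplacian_isHomogeneous {n : ℕ} (α : Fin n → ℝ) {d : ℕ}
    {u : MvPolynomial (Fin n) ℝ} (hu : u.IsHomogeneous (d + 2)) :
    (dunklLaplacian α u).IsHomogeneous d := by
  have hq : (∑ j : Fin n, X j ^ 2 : MvPolynomial (Fin n) ℝ).IsHomogeneous 2 :=
    IsHomogeneous.sum _ _ _ fun j _ => isHomogeneous_X_pow j 2
  have h := dunklLaplacian_pow_mul_polyDunkl α 1 (C 1)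
  rw [pow_one, pow_one, map_one, mul_one, ← C_1] at h
  have h1 : dunklLaplacian α u = polyDunkl α (∑ j, X j ^ 2) u := by
    rw [← h, Module.End.mul_apply, polyDunkl_C, one_smul]
  refine isHomogeneous_of_degree_eq fun e he => ?_
  rw [h1] at he
  have := degree_of_coeff_polyDunkl_ne_zero α hq hu he
  omega

/-- Iterating Euler's identity evaluates the Gaussian functional: on homogeneous polynomials of
degree `2 r` it is a multiple of the constant `Δ_h^r u`. -/
theorem eval_dunklLaplacian_pow {n : ℕ} (α : Fin n → ℝ) (hα : ∀ j, 0 ≤ α j) (r : ℕ)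
    {u : MvPolynomial (Fin n) ℝ} (hu : u.IsHomogeneous (2 * r)) (x : Fin n → ℝ) :
    (∏ j, Real.Gamma (α j + 1 / 2)) * eval x ((dunklLaplacian α ^ r) u)
      = 4 ^ r * r.factorial * gaussFunctional α u := by
  induction r generalizing u with
  | zero =>
    obtain ⟨a, rfl⟩ : ∃ a, u = C a :=
      ⟨_, totalDegree_eq_zero_iff_eq_C.1 (Nat.le_zero.1 hu.totalDegree_le)⟩
    have h0 : gaussFunctional α (C a) = a * ∏ j, Real.Gamma (α j + 1 / 2) := by
      rw [C_apply, gaussFunctional_monomial]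
      simp [gaussMoment]
    rw [h0]
    simp
    ring
  | succ r ih =>
    rw [pow_succ, Module.End.mul_apply, ih (dunklLaplacian_isHomogeneous α hu),
      gaussFunctional_dunklLaplacian α hα hu, Nat.factorial_succ]
    push_cast
    ring

/-! ### The pairing with an `h`-harmonic polynomial -/

/-- The adjoint of `P(𝒟)` takes `1` to `2^m e^{-Δ_h/4} P`, where the exponential series is truncated
beyond its last nonzero term. The induction uses that conjugating multiplication by `x_j` with
`e^{-Δ_h/4}` gives `x_j - 𝒟_j / 2`. -/
theorem gaussFunctional_polyDunkl {n : ℕ} (α : Fin n → ℝ) (hα : ∀ j, 0 ≤ α j) {m : ℕ}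
    {P : MvPolynomial (Fin n) ℝ} (hP : P.IsHomogeneous m) :
    ∃ N₀, ∀ N, N₀ ≤ N → (dunklLaplacian α ^ N) P = 0 ∧ ∀ u,
      gaussFunctional α (polyDunkl α P u) = 2 ^ m * gaussFunctional α
        (u * ∑ s ∈ Finset.range N, ((-1 / 4 : ℝ) ^ s / s.factorial) • (dunklLaplacian α ^ s) P) := by
  refine homogeneous_induction (M := fun m P => ∃ N₀, ∀ N, N₀ ≤ N →
    (dunklLaplacian α ^ N) P = 0 ∧ ∀ u, gaussFunctional α (polyDunkl α P u)
      = 2 ^ m * gaussFunctional α (u * ∑ s ∈ Finset.range N,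
        ((-1 / 4 : ℝ) ^ s / s.factorial) • (dunklLaplacian α ^ s) P)) ?_ ?_ ?_ ?_ hP
  · refine fun m => ⟨0, fun N _ => ⟨map_zero _, fun u => ?_⟩⟩
    rw [← C_0, polyDunkl_C]
    simp
  · intro a
    have h : ∀ s, (dunklLaplacian α ^ (s + 1)) (C a) = 0 := fun s => by
      rw [pow_succ, Module.End.mul_apply]
      simp [dunklLaplacian, sq, dunkl_C]
    refine ⟨1, fun N hN => ?_⟩
    obtain ⟨t, rfl⟩ := Nat.exists_eq_add_of_le' hN
    refine ⟨h t, fun u => ?_⟩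
    rw [Finset.sum_range_succ']
    simp [h, polyDunkl_C, mul_comm u, ← smul_eq_C_mul]
  · rintro m p q ⟨N₁, h₁⟩ ⟨N₂, h₂⟩
    refine ⟨max N₁ N₂, fun N hN => ?_⟩
    have h₁ := h₁ N (le_of_max_le_left hN)
    have h₂ := h₂ N (le_of_max_le_right hN)
    refine ⟨by rw [map_add, h₁.1, h₂.1, add_zero], fun u => ?_⟩
    rw [polyDunkl_add, LinearMap.add_apply, map_add, h₁.2, h₂.2, ← mul_add, ← map_add, ← mul_add,
      ← Finset.sum_add_distrib]
    simp only [map_add, smul_add]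
  · rintro m p j ⟨N₀, h⟩
    refine ⟨N₀ + 1, fun N hN => ?_⟩
    obtain ⟨t, rfl⟩ : ∃ t, N = t + 1 := ⟨N - 1, by omega⟩
    have hs := h (t + 1) (by omega)
    have ht := h t (by omega)
    refine ⟨by rw [dunklLaplacian_pow_X_mul, hs.1, ht.1]; simp, fun u => ?_⟩
    set E := ∑ s ∈ Finset.range t, ((-1 / 4 : ℝ) ^ s / s.factorial) • (dunklLaplacian α ^ s) p
      with hE
    have hE' : ∑ s ∈ Finset.range (t + 1), ((-1 / 4 : ℝ) ^ s / s.factorial) •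
        (dunklLaplacian α ^ s) p = E := by
      rw [Finset.sum_range_succ, ht.1, smul_zero, add_zero]
    have hX : ∑ s ∈ Finset.range (t + 1), ((-1 / 4 : ℝ) ^ s / s.factorial) •
        (dunklLaplacian α ^ s) (X j * p) = X j * E - (1 / 2 : ℝ) • dunkl α j E := by
      have hE₁ : E = ∑ s ∈ Finset.range t, ((-1 / 4 : ℝ) ^ (s + 1) / (s + 1).factorial) •
          (dunklLaplacian α ^ (s + 1)) p + p := by
        rw [← hE', Finset.sum_range_succ']
        simp
      nth_rewrite 1 [hE₁]
      rw [Finset.sum_range_succ', mul_add]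
      simp only [dunklLaplacian_pow_X_mul, smul_add, Finset.sum_add_distrib, hE, map_sum,
        map_smul, Finset.mul_sum, Finset.smul_sum, smul_smul, mul_smul_comm]
      have h1 : ∀ s : ℕ, (-1 / 4 : ℝ) ^ (s + 1) / ((s + 1).factorial : ℝ) * (2 * (s + 1 : ℝ))
          = - (1 / 2 * ((-1 / 4 : ℝ) ^ s / s.factorial)) := by
        intro s
        rw [Nat.factorial_succ, pow_succ]
        have : (s.factorial : ℝ) ≠ 0 := by positivity
        push_cast
        field_simp
        ring
      simp only [h1, neg_smul, Finset.sum_neg_distrib, pow_zero, Module.End.one_apply,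
        Nat.factorial_zero, Nat.cast_one, div_one, one_smul]
      abel
    have hb := gaussFunctional_by_parts α hα j u E
    rw [polyDunkl_X_mul, ht.2, hX, mul_sub, map_sub, mul_smul_comm, map_smul, smul_eq_mul, pow_succ,
      show u * (X j * E) = X j * u * E by ring]
    linear_combination 2 ^ m * hb

/-- Pairing with an `h`-harmonic polynomial `Y` amounts to applying `Y(𝒟)`, as
`e^{-Δ_h/4} Y = Y`. -/
theorem gaussFunctional_polyDunkl_of_harmonic {n : ℕ} (α : Fin n → ℝ) (hα : ∀ j, 0 ≤ α j) {m : ℕ}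
    {Y : MvPolynomial (Fin n) ℝ} (hY : IsSphericalHHarmonic α m Y) (f : MvPolynomial (Fin n) ℝ) :
    gaussFunctional α (polyDunkl α Y f) = 2 ^ m * gaussFunctional α (f * Y) := by
  obtain ⟨N₀, h⟩ := gaussFunctional_polyDunkl α hα hY.1
  have h0 : ∀ s, (dunklLaplacian α ^ (s + 1)) Y = 0 := fun s => by
    rw [pow_succ, Module.End.mul_apply, hY.2, map_zero]
  rw [(h (N₀ + 1) (by omega)).2, Finset.sum_range_succ']
  simp [h0]


/-! ### The Gaussian integral in polar coordinates -/

open Set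

theorem integral_gaussMoment {a : ℝ} (ha : 0 ≤ a) (d : ℕ) :
    ∫ x : ℝ, (|x| ^ a) ^ 2 * x ^ d * Real.exp (-x ^ 2) = gaussMoment a d := by
  rcases Nat.even_or_odd d with hd | hd
  · have h : ∀ x : ℝ, (|x| ^ a) ^ 2 * x ^ d * Real.exp (-x ^ 2)
        = (fun y : ℝ => (y ^ a) ^ 2 * y ^ d * Real.exp (-y ^ 2)) |x| := fun x => by
      simp only [hd.pow_abs, sq_abs]
    rw [integral_congr_ae (.of_forall h),
      integral_comp_abs (f := fun y : ℝ => (y ^ a) ^ 2 * y ^ d * Real.exp (-y ^ 2))]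
    have h2 : ∫ y in Ioi (0 : ℝ), (y ^ a) ^ 2 * y ^ d * Real.exp (-y ^ 2)
        = ∫ y in Ioi (0 : ℝ), y ^ (2 * a + d) * Real.exp (-y ^ (2 : ℝ)) := by
      refine setIntegral_congr_fun measurableSet_Ioi fun y (hy : 0 < y) => ?_
      rw [Real.rpow_add hy, Real.rpow_natCast, Real.rpow_two, mul_comm 2 a, Real.rpow_mul hy.le,
        Real.rpow_two]
    rw [h2, integral_rpow_mul_exp_neg_rpow two_pos (show (-1 : ℝ) < 2 * a + d by linarith [d.cast_nonneg (α := ℝ)])]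
    rw [gaussMoment, if_pos hd, show (2 * a + d + 1) / 2 = a + (d + 1) / 2 by ring]
    ring
  · rw [gaussMoment, if_neg (by simpa using hd)]
    have h := integral_neg_eq_self (fun x : ℝ => (|x| ^ a) ^ 2 * x ^ d * Real.exp (-x ^ 2)) volume
    simp only [abs_neg, hd.neg_pow, neg_sq, mul_neg, neg_mul, integral_neg] at h
    linarith

theorem integral_gaussian_monomial {n : ℕ} (α : Fin n → ℝ) (hα : ∀ j, 0 ≤ α j) (d : Fin n →₀ ℕ) :
    ∫ x : EuclideanSpace ℝ (Fin n), weight α x ^ 2 * (∏ j, x j ^ d j) * Real.exp (-‖x‖ ^ 2)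
      = ∏ j, gaussMoment (α j) (d j) := by
  have h : ∀ x : EuclideanSpace ℝ (Fin n),
      weight α x ^ 2 * (∏ j, x j ^ d j) * Real.exp (-‖x‖ ^ 2)
        = (fun y : Fin n → ℝ => ∏ j, ((|y j| ^ α j) ^ 2 * y j ^ d j * Real.exp (-y j ^ 2)))
          (WithLp.ofLp x) := by
    intro x
    simp only [weight, EuclideanSpace.norm_sq_eq, Real.norm_eq_abs, sq_abs,
      Finset.prod_mul_distrib, Finset.prod_pow, ← Real.exp_sum, Finset.sum_neg_distrib]
  simp only [h]
  rw [(PiLp.volume_preserving_ofLp (Fin n)).integral_comp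
    (MeasurableEquiv.toLp 2 (Fin n → ℝ)).symm.measurableEmbedding
    (fun y : Fin n → ℝ => ∏ j, ((|y j| ^ α j) ^ 2 * y j ^ d j * Real.exp (-y j ^ 2)))]
  rw [integral_fintype_prod_volume_eq_prod
    (f := fun j (t : ℝ) => (|t| ^ α j) ^ 2 * t ^ d j * Real.exp (-t ^ 2))]
  exact Finset.prod_congr rfl fun j _ => integral_gaussMoment (hα j) _

/-- Polar coordinates for the product of a homogeneous function and a radial function. -/
theorem integral_homogeneous_mul_radial {E : Type*} [NormedAddCommGroup E] [NormedSpace ℝ E]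
    [MeasurableSpace E] [BorelSpace E] [FiniteDimensional ℝ E] [Nontrivial E] (μ : Measure E)
    [μ.IsAddHaarMeasure] (H : E → ℝ) (g : ℝ → ℝ) (q : ℝ)
    (hH : ∀ (t : ℝ) (x : E), 0 < t → H (t • x) = t ^ q * H x) :
    ∫ x, H x * g ‖x‖ ∂μ = (∫ x : Metric.sphere (0 : E) 1, H x ∂μ.toSphere)
      * ∫ t in Ioi (0 : ℝ), t ^ (Module.finrank ℝ E - 1) * (t ^ q * g t) := by
  have h1 : ∫ x, H x * g ‖x‖ ∂μ
      = ∫ x : ({(0)}ᶜ : Set E), H x.1 * g ‖x.1‖ ∂(μ.comap (↑)) := by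
    rw [integral_subtype_comap (measurableSet_singleton _).compl fun x => H x * g ‖x‖,
      restrict_compl_singleton]
  have h2 : ∀ x : ({(0)}ᶜ : Set E), H x.1 * g ‖x.1‖
      = (fun p : Metric.sphere (0 : E) 1 × Ioi (0 : ℝ) => H p.1 * ((p.2 : ℝ) ^ q * g p.2))
        (homeomorphUnitSphereProd E x) := by
    intro x
    have hx : 0 < ‖x.1‖ := norm_pos_iff.2 x.2
    have hx' : x.1 = ‖x.1‖ • (‖x.1‖⁻¹ • x.1) := by rw [smul_smul, mul_inv_cancel₀ hx.ne', one_smul]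
    simp only [homeomorphUnitSphereProd_apply_fst_coe, homeomorphUnitSphereProd_apply_snd_coe]
    conv_lhs => rw [hx', hH _ _ hx, ← hx']
    ring
  rw [h1]
  simp only [h2]
  rw [μ.measurePreserving_homeomorphUnitSphereProd.integral_comp
    (Homeomorph.measurableEmbedding _) (fun p : Metric.sphere (0 : E) 1 × Ioi (0 : ℝ) =>
      H p.1 * ((p.2 : ℝ) ^ q * g p.2)),
    integral_prod_mul (fun x : Metric.sphere (0 : E) 1 => H x)
      (fun t : Ioi (0 : ℝ) => (t : ℝ) ^ q * g t)]
  congr 1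
  simp only [Measure.volumeIoiPow, ENNReal.ofReal]
  rw [integral_withDensity_eq_integral_smul,
    integral_subtype_comap measurableSet_Ioi fun a =>
      Real.toNNReal (a ^ (Module.finrank ℝ E - 1)) • (a ^ q * g a)]
  · refine setIntegral_congr_fun measurableSet_Ioi fun t ht => ?_
    rw [NNReal.smul_def, Real.coe_toNNReal _ (pow_nonneg ht.out.le _), smul_eq_mul]
  · exact (measurable_subtype_coe.pow_const _).real_toNNReal

theorem weight_smul {n : ℕ} (α : Fin n → ℝ) {t : ℝ} (ht : 0 < t) (x : EuclideanSpace ℝ (Fin n)) :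
    weight α (t • x) = t ^ (∑ j, α j) * weight α x := by
  simp only [weight, PiLp.smul_apply, smul_eq_mul, abs_mul, abs_of_pos ht]
  rw [Real.rpow_sum_of_pos ht, ← Finset.prod_mul_distrib]
  exact Finset.prod_congr rfl fun j _ => Real.mul_rpow ht.le (abs_nonneg _)

theorem integral_sphere_monomial {k : ℕ} (α : Fin (k + 1) → ℝ) (hα : ∀ j, 0 ≤ α j)
    (d : Fin (k + 1) →₀ ℕ) :
    (∫ x : Metric.sphere (0 : EuclideanSpace ℝ (Fin (k + 1))) 1,
      weight α x ^ 2 * ∏ j, (x : EuclideanSpace ℝ (Fin (k + 1))) j ^ d j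
        ∂(volume : Measure (EuclideanSpace ℝ (Fin (k + 1)))).toSphere)
      * Real.Gamma (mu α + 1 + d.degree / 2) = 2 * ∏ j, gaussMoment (α j) (d j) := by
  have hα' : 0 ≤ ∑ j, α j := Finset.sum_nonneg fun j _ => hα j
  have h := integral_homogeneous_mul_radial (volume : Measure (EuclideanSpace ℝ (Fin (k + 1))))
    (fun x => weight α x ^ 2 * ∏ j, x j ^ d j) (fun t => Real.exp (-t ^ 2))
    (2 * (∑ j, α j) + d.degree) (by
      intro t x ht
      have h1 : ∏ j, (t • x) j ^ d j = t ^ d.degree * ∏ j, x j ^ d j := by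
        simp only [PiLp.smul_apply, smul_eq_mul, mul_pow, Finset.prod_mul_distrib,
          Finset.prod_pow_eq_pow_sum, Finsupp.degree_eq_sum]
      simp only [weight_smul α ht, h1]
      rw [Real.rpow_add ht, Real.rpow_natCast, mul_comm 2, Real.rpow_mul ht.le, Real.rpow_two]
      ring)
  rw [integral_gaussian_monomial α hα] at h
  have h2 : ∫ t in Ioi (0 : ℝ), t ^ (Module.finrank ℝ (EuclideanSpace ℝ (Fin (k + 1))) - 1)
      * (t ^ (2 * (∑ j, α j) + d.degree) * Real.exp (-t ^ 2))
      = 1 / 2 * Real.Gamma (mu α + 1 + d.degree / 2) := by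
    have : ∫ t in Ioi (0 : ℝ), t ^ (Module.finrank ℝ (EuclideanSpace ℝ (Fin (k + 1))) - 1)
        * (t ^ (2 * (∑ j, α j) + d.degree) * Real.exp (-t ^ 2))
        = ∫ t in Ioi (0 : ℝ), t ^ (k + (2 * (∑ j, α j) + d.degree)) * Real.exp (-t ^ (2 : ℝ)) := by
      refine setIntegral_congr_fun measurableSet_Ioi fun t (ht : 0 < t) => ?_
      simp only [finrank_euclideanSpace, Fintype.card_fin, Nat.add_sub_cancel]
      rw [Real.rpow_add ht k, Real.rpow_natCast, Real.rpow_two, mul_assoc]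
    have hq : (0 : ℝ) ≤ k + (2 * (∑ j, α j) + d.degree) := by positivity
    rw [this, integral_rpow_mul_exp_neg_rpow two_pos (by linarith)]
    congr 2
    rw [mu]
    ring
  rw [h2] at h
  linarith

theorem continuous_weight {n : ℕ} (α : Fin n → ℝ) (hα : ∀ j, 0 ≤ α j) : Continuous (weight α) := by
  unfold weight
  refine continuous_finsetProd _ fun j _ => ?_
  exact Continuous.rpow_const (by fun_prop) fun x => Or.inr (hα j)

/-- The spherical integral of a homogeneous polynomial is its Gaussian functional divided by the
radial Gaussian integral. -/
theorem sphereIntegral_mul_Gamma {k : ℕ} (α : Fin (k + 1) → ℝ) (hα : ∀ j, 0 ≤ α j) {N : ℕ}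
    {f Y : MvPolynomial (Fin (k + 1)) ℝ} (h : (f * Y).IsHomogeneous N) :
    sphereIntegral α f Y * Real.Gamma (mu α + 1 + N / 2) = 2 * gaussFunctional α (f * Y) := by
  set P := f * Y with hP
  have h1 : sphereIntegral α f Y = ∑ d ∈ P.support, P.coeff d *
      ∫ x : Metric.sphere (0 : EuclideanSpace ℝ (Fin (k + 1))) 1,
      weight α x ^ 2 * ∏ j, (x : EuclideanSpace ℝ (Fin (k + 1))) j ^ d j
        ∂(volume : Measure (EuclideanSpace ℝ (Fin (k + 1)))).toSphere := by
    simp only [← integral_const_mul]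
    rw [← integral_finsetSum]
    · refine integral_congr_ae (Filter.Eventually.of_forall fun x => ?_)
      simp only
      rw [mul_assoc, ← map_mul, ← hP, eval_eq', Finset.mul_sum]
      exact Finset.sum_congr rfl fun d _ => by ring
    · intro d _
      have hc : Continuous fun x : Metric.sphere (0 : EuclideanSpace ℝ (Fin (k + 1))) 1 =>
          P.coeff d * (weight α x ^ 2 * ∏ j, (x : EuclideanSpace ℝ (Fin (k + 1))) j ^ d j) := by
        have := (continuous_weight α hα).comp
          (continuous_subtype_val (p := (· ∈ Metric.sphere (0 : EuclideanSpace ℝ (Fin (k + 1))) 1)))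
        exact continuous_const.mul ((this.pow 2).mul (by fun_prop))
      exact hc.integrable_of_hasCompactSupport (HasCompactSupport.of_compactSpace _)
  rw [h1, Finset.sum_mul]
  conv_rhs => rw [P.as_sum, map_sum, Finset.mul_sum]
  refine Finset.sum_congr rfl fun d hd => ?_
  rw [gaussFunctional_monomial, ← degree_eq_of_coeff_ne_zero h (mem_support_iff.1 hd)]
  linear_combination P.coeff d * integral_sphere_monomial α hα d

end DunklSphere

theorem theorem4p1 (k : ℕ) (hk : 1 ≤ k) (α : Fin (k + 1) → ℝ) (hα : ∀ j, 0 ≤ α j)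
    (hne : ¬ (k = 1 ∧ ∀ j, α j = 0))
    (l m : ℕ) (f Y : MvPolynomial (Fin (k + 1)) ℝ)
    (hf : f.IsHomogeneous l) (hY : DunklSphere.IsSphericalHHarmonic α m Y) :
    (∀ r : ℕ, l = m + 2 * r → ∀ x : Fin (k + 1) → ℝ,
      DunklSphere.sphereIntegral α f Y
        = 1 / ((2 : ℝ) ^ ((l : ℤ) - 1) * (r.factorial : ℝ))
          * ((∏ i, Real.Gamma (α i + 1 / 2))
              / Real.Gamma ((m : ℝ) + DunklSphere.mu α + (r : ℝ) + 1))
          * MvPolynomial.eval x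
              ((DunklSphere.dunklLaplacian α ^ r) (DunklSphere.polyDunkl α Y f))) ∧
    ((l < m ∨ Odd ((l : ℤ) - (m : ℤ))) → DunklSphere.sphereIntegral α f Y = 0) := by
  have hS := DunklSphere.sphereIntegral_mul_Gamma α hα (hf.mul hY.1)
  have hG := DunklSphere.gaussFunctional_polyDunkl_of_harmonic α hα hY f
  have hΓ : 0 < Real.Gamma (DunklSphere.mu α + 1 + ((l + m : ℕ) : ℝ) / 2) := by
    have hα' : 0 ≤ ∑ j, α j := Finset.sum_nonneg fun j _ => hα j
    have : DunklSphere.mu α + 1 = ∑ j, α j + ((k : ℝ) + 1) / 2 := by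
      rw [DunklSphere.mu]
      ring
    rw [this]
    exact Real.Gamma_pos_of_pos (by positivity)
  refine ⟨fun r hr x => ?_, fun h => ?_⟩
  · have hu : (DunklSphere.polyDunkl α Y f).IsHomogeneous (2 * r) := by
      refine DunklSphere.isHomogeneous_of_degree_eq fun d hd => ?_
      have := DunklSphere.degree_of_coeff_polyDunkl_ne_zero α hY.1 hf hd
      omega
    have hE := DunklSphere.eval_dunklLaplacian_pow α hα r hu x
    rw [show DunklSphere.mu α + 1 + ((l + m : ℕ) : ℝ) / 2
      = (m : ℝ) + DunklSphere.mu α + (r : ℝ) + 1 by rw [hr]; push_cast; ring] at hS hΓ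
    have h2 : (2 : ℝ) ^ ((l : ℤ) - 1) = 2 ^ m * 4 ^ r / 2 := by
      rw [zpow_sub₀ two_ne_zero, zpow_natCast, zpow_one, hr, pow_add, pow_mul]
      norm_num
    have hr0 : (r.factorial : ℝ) ≠ 0 := by positivity
    rw [h2]
    generalize ∏ j, Real.Gamma (α j + 1 / 2) = c at hE ⊢
    field_simp
    linear_combination (2 ^ m * 4 ^ r * r.factorial : ℝ) * hS - 2 * hE
      - (2 * 4 ^ r * r.factorial : ℝ) * hG
  · suffices h0 : DunklSphere.gaussFunctional α (f * Y) = 0 by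
      rw [h0, mul_zero] at hS
      exact (mul_eq_zero.1 hS).resolve_right hΓ.ne'
    rcases h with h | h
    · have h0 : DunklSphere.polyDunkl α Y f = 0 := by
        ext d
        by_contra hd
        have := DunklSphere.degree_of_coeff_polyDunkl_ne_zero α hY.1 hf hd
        omega
      rw [h0, map_zero] at hG
      exact (mul_eq_zero.1 hG.symm).resolve_left (by positivity)
    · refine DunklSphere.gaussFunctional_of_odd α ?_ (hf.mul hY.1)
      obtain ⟨t, ht⟩ := h
      exact Nat.odd_iff.2 (by omega)
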